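/- Let $k$ be a field of characteristic $0$, $\mathcal T$ the set of (isomorphism classes of) finite rooted trees, $|t|$ the number of vertices of $t$, and $\bullet$ the one-vertex tree. Let $k\{\mathcal T\}$ be the vector space with basis $\mathcal T$. On it let $\mathfrak N(t)=\sum_{t'}n(t;t')\,t'$ and $\mathfrak P(t)=\sum_{t'}m(t';t)\,t'$, where $n(t;t')$ is the number of vertices of $t$ to which a new edge with a new terminal vertex can be added to obtain $t'$, and $m(t';t)$ is the number of terminal edges of $t$ whose removal, together with their terminal vertex, leaves $t'$ (so $\mathfrak P(\bullet)=0$). Let $(t,t')=|SG(t)|\,\delta_{t,t'}$, extended bilinearly, where $SG(t)$ is the direct product over the vertices $v$ of $t$ of the groups of permutations of isomorphic branches at $v$. Let $\mathcal H_K$ be the commutative polynomial algebra over $k$ on $\mathcal T$, graded by giving a tree $t$ degree $|t|$, with graded dual $\mathcal H_K^{gr}$ (the linear functionals that vanish on all but finitely many homogeneous parts). Let $N$ and $P$ be the derivations of $\mathcal H_K$ with $N(t)=\mathfrak N(t)$ for all trees $t$, $P(t)=\mathfrak P(t)$ for trees with $|t|\ge 2$, and $P(\bullet)=1$; let $N^*,P^*:\mathcal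 H_K^{gr}\to\mathcal H_K^{gr}$ be their transposes. Let $B_+:\mathcal H_K\to k\{\mathcal T\}$ be the linear isomorphism that sends a monomial $t_1\cdots t_r$ to the tree obtained by joining the roots of $t_1,\dots,t_r$ to a new root (so $B_+(1)=\bullet$), and $B_-=B_+^{-1}$. Let $\mathcal H_{GL}$ be $k\{\mathcal T\}$ with the Grossman–Larson product: if $B_-(t)=t_1\cdots t_r$, then $t\circ s$ is the sum, over all $|s|^r$ maps $f$ from $\{1,\dots,r\}$ to the vertices of $s$, of the tree obtained from $s$ by attaching each $t_i$ to $f(i)$ by a new edge. Let $\chi:\mathcal H_{GL}\to\mathcal H_K^{gr}$ be the (linear) isomorphism given by $\langle\chi(t),u\rangle=(t,B_+(u))$. Then: 1. The map $\chi^{-1}P^*\chi:\mathcal H_{GL}\to\mathcal H_{GL}$ is left multiplication by $B_+(\bullet)$, and this is $\mathfrak N$; that is, $\chi^{-1}P^*\chi(t)=B_+(\bullet)\circ t=\mathfrak N(t)$ for all rooted trees $t$. 2. For all rooted trees $t$, $\chi^{-1}N^*\chi(t)=\mathfrak P(t)-B_+\left(\frac{\partial}{\partial\bullet}B_-(t)\right)$,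 where $\frac{\partial}{\partial\bullet}$ is the partial derivative of polynomials in $\mathcal H_K$ with respect to the generator $\bullet$. -/

import Mathlib

noncomputable section

open scoped Classical

namespace RootedTrees

/-! ### Finite rooted trees -/

/-- A finite rooted tree together with an ordering of the children of each vertex:
a root with `n` children, carrying the branches `c 0, …, c (n - 1)`. -/
inductive PlaneTree : Type
  | node (n : ℕ) (c : Fin n → PlaneTree) : PlaneTree

namespace PlaneTree

/-- Isomorphism of the underlying rooted trees, i.e. up to reordering children. -/
def Iso : PlaneTree → PlaneTree → Prop
  | node n c, node m d => ∃ σ : Fin n ≃ Fin m, ∀ i, Iso (c i) (d (σ i))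

theorem Iso.refl : ∀ t : PlaneTree, Iso t t
  | node _ c => ⟨Equiv.refl _, fun i => Iso.refl (c i)⟩

theorem Iso.symm : ∀ {t s : PlaneTree}, Iso t s → Iso s t
  | node _ _, node _ d, ⟨σ, h⟩ => ⟨σ.symm, fun j => by
      have h1 := h (σ.symm j)
      rw [σ.apply_symm_apply] at h1
      exact Iso.symm h1⟩

theorem Iso.trans : ∀ {t s r : PlaneTree}, Iso t s → Iso s r → Iso t r
  | node _ _, node _ _, node _ _, ⟨σ, h⟩, ⟨τ, g⟩ =>
      ⟨σ.trans τ, fun i => Iso.trans (h i) (g (σ i))⟩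

instance setoid : Setoid PlaneTree := ⟨Iso, Iso.refl, Iso.symm, Iso.trans⟩

/-- The vertices: the root (`none`) and the vertices of the branches. -/
def Vertex : PlaneTree → Type
  | node n c => Option ((i : Fin n) × Vertex (c i))

/-- The edges: for each `i`, the edge from the root to the root of the `i`-th branch (`none`),
and the edges of the `i`-th branch. -/
def Edge : PlaneTree → Type
  | node n c => (i : Fin n) × Option (Edge (c i))

instance fintypeVertex : ∀ t : PlaneTree, Fintype (Vertex t)
  | node n c =>
      haveI : ∀ i, Fintype (Vertex (c i)) := fun i => fintypeVertex (c i)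
      inferInstanceAs (Fintype (Option ((i : Fin n) × Vertex (c i))))

instance fintypeEdge : ∀ t : PlaneTree, Fintype (Edge t)
  | node n c =>
      haveI : ∀ i, Fintype (Edge (c i)) := fun i => fintypeEdge (c i)
      inferInstanceAs (Fintype ((i : Fin n) × Option (Edge (c i))))

/-- The number of children of the root. -/
def arity : PlaneTree → ℕ
  | node n _ => n

/-- The branches at the root. -/
def child : (t : PlaneTree) → Fin t.arity → PlaneTree
  | node _ c => c

/-- The subtree formed by a vertex and its descendants. -/
def subtree : (t : PlaneTree) → Vertex t → PlaneTree
  | node n c, none => node n c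
  | node _ c, some ⟨i, v⟩ => subtree (c i) v

/-- An edge is terminal if its lower end has no children. -/
def IsTerminal : (t : PlaneTree) → Edge t → Prop
  | node _ c, ⟨i, none⟩ => (c i).arity = 0
  | node _ c, ⟨i, some e⟩ => IsTerminal (c i) e

end PlaneTree

open PlaneTree

/-- The set `𝒯` of finite rooted trees (up to isomorphism). -/
def RTree : Type := Quotient PlaneTree.setoid

instance : DecidableEq RTree := Classical.decEq _

namespace RTree

/-- The rooted tree underlying a plane tree. -/
def mk (t : PlaneTree) : RTree := Quotient.mk _ t

theorem mk_eq_iff {t s : PlaneTree} : mk t = mk s ↔ PlaneTree.Iso t s :=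
  Quotient.eq

/-- The forest obtained from a tree by deleting its root. -/
def branches (t : RTree) : Multiset RTree :=
  Quotient.liftOn t (fun t => Finset.univ.val.map fun i => mk (t.child i)) (by
    rintro ⟨n, c⟩ ⟨m, d⟩ ⟨σ, h⟩
    show Finset.univ.val.map (fun i : Fin n => mk (c i)) =
      Finset.univ.val.map (fun i : Fin m => mk (d i))
    rw [← Multiset.map_univ_val_equiv σ, Multiset.map_map]
    exact Multiset.map_congr rfl fun i _ => mk_eq_iff.2 (h i))

theorem branches_mk (n : ℕ) (c : Fin n → PlaneTree) :
    branches (mk (node n c)) = Finset.univ.val.map fun i => mk (c i) := rfl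

theorem branches_bijective : Function.Bijective branches := by
  constructor
  · rintro ⟨n, c⟩ ⟨m, d⟩ h
    change Finset.univ.val.map (fun i : Fin n => mk (c i)) =
      Finset.univ.val.map (fun i : Fin m => mk (d i)) at h
    refine mk_eq_iff.2 ?_
    have key : ∀ x : RTree, Nonempty ({i // mk (c i) = x} ≃ {j // mk (d j) = x}) := by
      intro x
      rw [← Fintype.card_eq, Fintype.card_subtype, Fintype.card_subtype]
      have := congrArg (Multiset.count x) h
      rw [Multiset.count_map, Multiset.count_map] at this
      simpa [Finset.card, Finset.filter, eq_comm] using this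
    have e := fun x => Classical.choice (key x)
    let σ : Fin n ≃ Fin m :=
      (Equiv.sigmaFiberEquiv fun i => mk (c i)).symm.trans
        ((Equiv.sigmaCongrRight fun x => e x).trans (Equiv.sigmaFiberEquiv fun j => mk (d j)))
    refine ⟨σ, fun i => mk_eq_iff.1 ?_⟩
    exact (e (mk (c i)) ⟨i, rfl⟩).2.symm
  · intro u
    induction u using Quotient.inductionOn with
    | _ l =>
      refine ⟨mk (node l.length fun i => (l.get i).out), ?_⟩
      rw [branches_mk]
      have h : (fun i : Fin l.length => mk (l.get i).out) = l.get := by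
        funext i
        exact Quotient.out_eq _
      rw [h]
      have h2 : (Finset.univ : Finset (Fin l.length)).val = (List.finRange l.length : Multiset _) :=
        rfl
      rw [h2, Multiset.map_coe]
      simp

/-- Joining the trees of a forest to a new root, the inverse of deleting the root. -/
def graft (u : Multiset RTree) : RTree := (Equiv.ofBijective branches branches_bijective).symm u

theorem branches_graft (u : Multiset RTree) : branches (graft u) = u :=
  (Equiv.ofBijective branches branches_bijective).apply_symm_apply u

theorem graft_branches (t : RTree) : graft (branches t) = t :=
  (Equiv.ofBijective branches branches_bijective).symm_apply_apply t

/-- The tree `•` consisting of only the root vertex. -/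
def bullet : RTree := graft 0

/-- The number `|t|` of vertices. -/
def size (t : RTree) : ℕ :=
  Quotient.liftOn t (fun t => Fintype.card (Vertex t)) (by
    intro t s h
    induction t generalizing s with
    | node n c ih =>
      obtain ⟨m, d⟩ := s
      obtain ⟨σ, h⟩ := h
      show Fintype.card (Option ((i : Fin n) × Vertex (c i))) =
        Fintype.card (Option ((i : Fin m) × Vertex (d i)))
      simp only [Fintype.card_option, Fintype.card_sigma]
      rw [← Equiv.sum_comp σ]
      congr 1
      exact Finset.sum_congr rfl fun i _ => ih i (d (σ i)) (h i))

theorem size_mk (t : PlaneTree) : size (mk t) = Fintype.card (Vertex t) := rfl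

theorem size_eq (t : RTree) : size t = (t.branches.map size).sum + 1 := by
  obtain ⟨⟨n, c⟩⟩ := t
  change Fintype.card (Option ((i : Fin n) × Vertex (c i))) =
    ((Finset.univ.val.map fun i => mk (c i)).map size).sum + 1
  simp only [Fintype.card_option, Fintype.card_sigma, Multiset.map_map]
  rfl

theorem size_graft (u : Multiset RTree) : size (graft u) = (u.map size).sum + 1 := by
  rw [size_eq, branches_graft]

theorem size_pos (t : RTree) : 0 < size t := by rw [size_eq]; omega

/-- `attach s F`: the tree obtained from `s` by joining, for each vertex `v`, the roots of the
trees in the forest `F v` to `v` by new edges. -/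
def attach : (s : PlaneTree) → (Vertex s → Multiset RTree) → RTree
  | node _ c, F =>
      graft (F none + Finset.univ.val.map fun i => attach (c i) fun v => F (some ⟨i, v⟩))

/-- `prune s e`: what remains at the root of `s` when the edge `e`, and whatever hangs from it,
is removed. -/
def prune : (s : PlaneTree) → Edge s → RTree
  | node _ c, ⟨i, none⟩ => graft ((Finset.univ.erase i).val.map fun j => mk (c j))
  | node _ c, ⟨i, some e⟩ =>
      graft (prune (c i) e ::ₘ (Finset.univ.erase i).val.map fun j => mk (c j))

theorem exists_vertex_equiv {s s' : PlaneTree} (h : PlaneTree.Iso s s') :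
    ∃ e : Vertex s ≃ Vertex s', ∀ F : Vertex s' → Multiset RTree,
      attach s (fun v => F (e v)) = attach s' F := by
  induction s generalizing s' with
  | node n c ih =>
    obtain ⟨m, d⟩ := s'
    obtain ⟨σ, h⟩ := h
    choose e he using fun i => ih i (h i)
    refine ⟨Equiv.optionCongr (Equiv.sigmaCongr σ e), fun F => ?_⟩
    show graft (F none + Finset.univ.val.map fun i =>
        attach (c i) fun v => F (some ⟨σ i, e i v⟩)) =
      graft (F none + Finset.univ.val.map fun i => attach (d i) fun v => F (some ⟨i, v⟩))
    rw [← Multiset.map_univ_val_equiv σ, Multiset.map_map]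
    congr 2
    exact Multiset.map_congr rfl fun i _ => he i fun v => F (some ⟨σ i, v⟩)

theorem map_erase_univ {n m : ℕ} {c : Fin n → PlaneTree} {d : Fin m → PlaneTree}
    (σ : Fin n ≃ Fin m) (h : ∀ i, PlaneTree.Iso (c i) (d (σ i))) (i : Fin n) :
    ((Finset.univ.erase i).val.map fun j => mk (c j)) =
      (Finset.univ.erase (σ i)).val.map fun j => mk (d j) := by
  have : Finset.univ.erase (σ i) = (Finset.univ.erase i).map σ.toEmbedding := by
    rw [Finset.map_erase, Finset.map_univ_equiv]; rfl
  rw [this, Finset.map_val, Multiset.map_map]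
  exact Multiset.map_congr rfl fun j _ => mk_eq_iff.2 (h j)

theorem exists_edge_equiv {s s' : PlaneTree} (h : PlaneTree.Iso s s') :
    ∃ e : Edge s ≃ Edge s', ∀ a, (IsTerminal s a ↔ IsTerminal s' (e a)) ∧
      prune s a = prune s' (e a) := by
  induction s generalizing s' with
  | node n c ih =>
    obtain ⟨m, d⟩ := s'
    obtain ⟨σ, h⟩ := h
    choose e he using fun i => ih i (h i)
    refine ⟨Equiv.sigmaCongr σ fun i => Equiv.optionCongr (e i), ?_⟩
    rintro ⟨i, _ | a⟩
    · refine ⟨?_, congrArg graft (map_erase_univ σ h i)⟩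
      have harity : (c i).arity = (d (σ i)).arity := by
        have hi := h i
        generalize c i = x at hi
        generalize d (σ i) = y at hi
        obtain ⟨p, x⟩ := x
        obtain ⟨q, y⟩ := y
        obtain ⟨τ, -⟩ := hi
        show p = q
        simpa using Fintype.card_congr τ
      show (c i).arity = 0 ↔ (d (σ i)).arity = 0
      rw [harity]
    · refine ⟨(he i a).1, ?_⟩
      have h1 := map_erase_univ σ h i
      have h2 := (he i a).2
      exact congrArg graft (congrArg₂ Multiset.cons h2 h1)

/-- The number of vertices of `t` to which a new edge (with a new terminal vertex) can be added
to obtain `t'`. It is nonzero iff `t'` covers `t`. -/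
def growthMult (t t' : RTree) : ℕ :=
  Quotient.liftOn t
    (fun s => Nat.card {v : Vertex s // attach s (fun w => if w = v then {bullet} else 0) = t'})
    (by
      intro s s' h
      obtain ⟨e, he⟩ := exists_vertex_equiv h
      refine Nat.card_congr (e.subtypeEquiv fun v => ?_)
      rw [← he]
      simp)

/-- The number of (terminal) edges of `t'` which when removed (with their terminal vertex)
leave `t`. It is nonzero iff `t'` covers `t`. -/
def pruneMult (t t' : RTree) : ℕ :=
  Quotient.liftOn t'
    (fun s => Nat.card {a : Edge s // IsTerminal s a ∧ prune s a = t})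
    (by
      intro s s' h
      obtain ⟨e, he⟩ := exists_edge_equiv h
      refine Nat.card_congr (e.subtypeEquiv fun a => ?_)
      rw [(he a).1, (he a).2])

/-- The group of permutations of isomorphic branches at the root. -/
def rootSymmetry (t : PlaneTree) : Subgroup (Equiv.Perm (Fin t.arity)) where
  carrier := {σ | ∀ i, mk (t.child (σ i)) = mk (t.child i)}
  one_mem' := fun _ => rfl
  mul_mem' := fun {_ τ} hσ hτ i => (hσ (τ i)).trans (hτ i)
  inv_mem' := fun {σ} hσ i => by
    have := hσ (σ⁻¹ i)
    rw [Equiv.Perm.inv_def, σ.apply_symm_apply] at this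
    exact this.symm

/-- The symmetry group: the direct product over all vertices `v` of the groups of permutations
of isomorphic branches at `v`. -/
abbrev SymmetryGroup (t : PlaneTree) : Type := (v : Vertex t) → rootSymmetry (t.subtree v)

theorem card_symmetryGroup_node (n : ℕ) (c : Fin n → PlaneTree) :
    Nat.card (SymmetryGroup (node n c)) =
      Nat.card (rootSymmetry (node n c)) * ∏ i, Nat.card (SymmetryGroup (c i)) := by
  rw [Nat.card_pi]
  change ∏ v : Option ((i : Fin n) × Vertex (c i)),
    Nat.card (rootSymmetry ((node n c).subtree v)) = _
  rw [Fintype.prod_option, Fintype.prod_sigma]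
  simp_rw [Nat.card_pi]
  rfl

/-- The order of the symmetry group of a rooted tree. -/
def symCard (t : RTree) : ℕ :=
  Quotient.liftOn t (fun t => Nat.card (SymmetryGroup t)) (by
    intro t s h
    show Nat.card (SymmetryGroup t) = Nat.card (SymmetryGroup s)
    induction t generalizing s with
    | node n c ih =>
      obtain ⟨m, d⟩ := s
      obtain ⟨σ, h⟩ := h
      rw [card_symmetryGroup_node, card_symmetryGroup_node, ← Equiv.prod_comp σ]
      congr 1
      · have h' : ∀ i, mk (c i) = mk (d (σ i)) := fun i => mk_eq_iff.2 (h i)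
        refine Nat.card_congr (σ.permCongr.subtypeEquiv fun τ => ?_)
        show (∀ i, mk (c (τ i)) = mk (c i)) ↔ ∀ j, mk (d (σ (τ (σ.symm j)))) = mk (d j)
        simp only [h']
        rw [← σ.forall_congr_right (q := fun j => mk (d (σ (τ (σ.symm j)))) = mk (d j))]
        simp
      · exact Finset.prod_congr rfl fun i _ => ih i (d (σ i)) (h i))

theorem symCard_pos (t : RTree) : 0 < symCard t := by
  obtain ⟨t⟩ := t
  exact Nat.card_pos (α := SymmetryGroup t)

theorem size_attach (s : PlaneTree) (F : Vertex s → Multiset RTree) :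
    size (attach s F) = size (mk s) + ∑ v, ((F v).map size).sum := by
  induction s with
  | node n c ih =>
    change size (graft (F none + Finset.univ.val.map fun i =>
      attach (c i) fun v => F (some ⟨i, v⟩))) = size (mk (node n c)) +
        ∑ v : Option ((i : Fin n) × Vertex (c i)), ((F v).map size).sum
    rw [size_graft, size_eq, branches_mk, Fintype.sum_option, Fintype.sum_sigma,
      Multiset.map_add, Multiset.sum_add, Multiset.map_map, Multiset.map_map]
    change _ + (∑ i, size (attach (c i) fun v => F (some ⟨i, v⟩))) + 1 =
      (∑ i, size (mk (c i))) + 1 + _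
    simp_rw [ih]
    rw [Finset.sum_add_distrib]
    ring

theorem size_prune (s : PlaneTree) (a : Edge s) (ha : IsTerminal s a) :
    size (prune s a) + 1 = size (mk s) := by
  induction s with
  | node n c ih =>
    have hs : ∀ i, size (mk (node n c)) = size (mk (c i)) +
        (∑ j ∈ Finset.univ.erase i, size (mk (c j))) + 1 := fun i => by
      rw [Finset.add_sum_erase _ (fun j => size (mk (c j))) (Finset.mem_univ i), size_eq,
        branches_mk, Multiset.map_map]
      rfl
    obtain ⟨i, _ | a⟩ := a
    · have h1 : size (mk (c i)) = 1 := by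
        change (c i).arity = 0 at ha
        generalize c i = x at ha
        obtain ⟨p, x⟩ := x
        obtain rfl : p = 0 := ha
        rw [size_eq, branches_mk]
        simp
      change size (graft ((Finset.univ.erase i).val.map fun j => mk (c j))) + 1 = _
      rw [hs i, size_graft, Multiset.map_map]
      change (∑ j ∈ Finset.univ.erase i, size (mk (c j))) + 1 + 1 =
        size (mk (c i)) + (∑ j ∈ Finset.univ.erase i, size (mk (c j))) + 1
      omega
    · have h1 := ih i a ha
      change size (graft (prune (c i) a ::ₘ
        (Finset.univ.erase i).val.map fun j => mk (c j))) + 1 = _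
      rw [hs i, size_graft, Multiset.map_cons, Multiset.sum_cons, Multiset.map_map]
      change size (prune (c i) a) + (∑ j ∈ Finset.univ.erase i, size (mk (c j))) + 1 + 1 =
        size (mk (c i)) + (∑ j ∈ Finset.univ.erase i, size (mk (c j))) + 1
      omega

theorem size_of_growthMult {t t' : RTree} (h : growthMult t t' ≠ 0) : size t' = size t + 1 := by
  obtain ⟨s⟩ := t
  obtain ⟨⟨v, hv⟩⟩ := (Nat.card_ne_zero.1 h).1
  rw [← hv, size_attach, Finset.sum_eq_single v]
  · simp only [if_true, Multiset.map_singleton, Multiset.sum_singleton]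
    rw [bullet, size_graft]
    rfl
  · intro w _ hw
    simp [hw]
  · simp

theorem size_of_pruneMult {t t' : RTree} (h : pruneMult t t' ≠ 0) : size t + 1 = size t' := by
  obtain ⟨s⟩ := t'
  obtain ⟨⟨a, ha, hp⟩⟩ := (Nat.card_ne_zero.1 h).1
  rw [← hp]
  exact size_prune s a ha

theorem finite_size_le (M : ℕ) : {t : RTree | size t ≤ M}.Finite := by
  induction M with
  | zero =>
    refine Set.Finite.subset Set.finite_empty fun t ht => ?_
    have := size_pos t
    simp at ht
    omega
  | succ M ih =>
    have hfin : (⋃ n ∈ Finset.range (M + 1),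
        ((fun l : Fin n → RTree => graft (Finset.univ.val.map l)) ''
          Set.univ.pi fun _ => {t : RTree | size t ≤ M})).Finite :=
      (Finset.range (M + 1)).finite_toSet.biUnion fun n _ =>
        (Set.Finite.pi' fun _ => ih).subset (by intro x hx; simpa using hx) |>.image _
    refine hfin.subset ?_
    rintro ⟨n, c⟩ ht
    change size (mk (node n c)) ≤ M + 1 at ht
    rw [size_eq, branches_mk, Multiset.map_map] at ht
    replace ht : ∑ i, size (mk (c i)) ≤ M := Nat.le_of_succ_le_succ ht
    have hn : n ≤ M := by
      refine le_trans ?_ ht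
      calc n = ∑ _i : Fin n, 1 := by simp
        _ ≤ _ := Finset.sum_le_sum fun i _ => size_pos _
    refine Set.mem_iUnion₂.2
      ⟨n, Finset.mem_range.2 (Nat.lt_succ_of_le hn), fun i => mk (c i), ?_, ?_⟩
    · intro i _
      exact le_trans (Finset.single_le_sum (f := fun i => size (mk (c i)))
        (fun _ _ => Nat.zero_le _) (Finset.mem_univ i)) ht
    · show graft (branches (mk (node n c))) = _
      rw [graft_branches]
      rfl

theorem finite_support_growthMult (t : RTree) : {t' | growthMult t t' ≠ 0}.Finite :=
  (finite_size_le (size t + 1)).subset fun _ h => (size_of_growthMult h).le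

theorem finite_support_pruneMult (t' : RTree) : {t | pruneMult t t' ≠ 0}.Finite :=
  (finite_size_le (size t')).subset fun t h => by
    have := size_of_pruneMult h
    show size t ≤ size t'
    omega

end RTree

open RootedTrees.RTree MvPolynomial

section Linear

variable (k : Type*) [Field k]

/-! ### The vector space of rooted trees -/

/-- The vector space `k{𝒯}` with basis the rooted trees. -/
abbrev TreeSpace : Type _ := RTree →₀ k

/-- The growth operator `𝔑`: the coefficient of `t'` in `𝔑(t)` is `n(t; t')`. -/
def growth : TreeSpace k →ₗ[k] TreeSpace k :=
  Finsupp.linearCombination k fun t =>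
    Finsupp.ofSupportFinite (fun t' => (growthMult t t' : k))
      ((finite_support_growthMult t).subset fun _ h h' => h (by simp [h']))

/-- The pruning operator `𝔓`: the coefficient of `t'` in `𝔓(t)` is `m(t'; t)`. -/
def pruning : TreeSpace k →ₗ[k] TreeSpace k :=
  Finsupp.linearCombination k fun t =>
    Finsupp.ofSupportFinite (fun t' => (pruneMult t' t : k))
      ((finite_support_pruneMult t).subset fun _ h h' => h (by simp [h']))

/-- The inner product on `k{𝒯}`, with `(t, t') = |SG(t)| δ_{t,t'}`. -/
def treeInner : TreeSpace k →ₗ[k] TreeSpace k →ₗ[k] k :=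
  Finsupp.linearCombination k fun t => (symCard t : k) • Finsupp.lapply t

/-- The product `t ∘ s` of rooted trees: if `t₁, …, t_r` are the branches of `t`, the sum over all
maps `f` from `{1, …, r}` to the vertices of `s` of the tree obtained by attaching each `tᵢ` to
the vertex `f i` of `s`. -/
def glTree (t s : RTree) : TreeSpace k :=
  Quotient.liftOn s
    (fun s => ∑ f : t.branches → Vertex s,
      Finsupp.single (attach s fun v => (Finset.univ.filter fun x => f x = v).val.map
        fun x : t.branches => (x : RTree)) 1)
    (by
      intro s s' h
      obtain ⟨e, he⟩ := exists_vertex_equiv h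
      refine Fintype.sum_equiv (Equiv.arrowCongr (Equiv.refl _) e) _ _ fun f => ?_
      rw [← he]
      simp)

/-- The Grossman–Larson product `∘` on `k{𝒯}`, the bilinear extension of the product of trees. -/
def glMul : TreeSpace k →ₗ[k] TreeSpace k →ₗ[k] TreeSpace k :=
  Finsupp.linearCombination k fun t => Finsupp.linearCombination k fun s => glTree k t s

/-! ### Kreimer's Hopf algebra -/

/-- The underlying algebra of Kreimer's Hopf algebra: the commutative polynomial algebra on the
rooted trees. Its monomials are the forests. -/
abbrev HK : Type _ := MvPolynomial RTree k

/-- The degree-`n` part of `HK`, where a rooted tree `t` has degree `|t|`. -/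
abbrev HKdeg (n : ℕ) : Submodule k (HK k) := weightedHomogeneousSubmodule k size n

/-- The inclusion of the trees (forests with one component) in `HK`. -/
def treeIncl : TreeSpace k →ₗ[k] HK k := Finsupp.linearCombination k fun t => X t

/-- The growth operator `N`: the derivation extending `𝔑`. -/
def growthK : Derivation k (HK k) (HK k) :=
  mkDerivation k fun t => treeIncl k (growth k (Finsupp.single t 1))

/-- The pruning operator `P`: the derivation with `P(t) = 𝔓(t)` for `|t| ≥ 2` and `P(•) = 1`. -/
def pruneK : Derivation k (HK k) (HK k) :=
  mkDerivation k fun t =>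
    if t = bullet then 1 else treeIncl k (pruning k (Finsupp.single t 1))

/-- Forests, as exponents of monomials, correspond to trees by joining to a new root. -/
def forestEquiv : (RTree →₀ ℕ) ≃ RTree :=
  Multiset.toFinsupp.symm.toEquiv.trans (Equiv.ofBijective branches branches_bijective).symm

/-- The linear isomorphism `B₊` from `HK` to `k{𝒯}`, sending a forest to the tree obtained by
joining its roots to a new root. Its inverse is `B₋`. -/
def Bplus : HK k ≃ₗ[k] TreeSpace k :=
  (basisMonomials RTree k).repr ≪≫ₗ Finsupp.domLCongr forestEquiv

theorem Bplus_monomial (u : RTree →₀ ℕ) (r : k) :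
    Bplus k (monomial u r) = Finsupp.single (graft (Finsupp.toMultiset u)) r := by
  have h : monomial u r = r • basisMonomials RTree k u := by
    simp [smul_monomial]
  rw [h, map_smul]
  simp only [Bplus, LinearEquiv.trans_apply, Module.Basis.repr_self, Finsupp.domLCongr_single,
    Finsupp.smul_single, smul_eq_mul, mul_one]
  rfl

theorem Bplus_symm_single (t : RTree) (r : k) :
    (Bplus k).symm (Finsupp.single t r) = monomial (Multiset.toFinsupp t.branches) r := by
  rw [LinearEquiv.symm_apply_eq, Bplus_monomial, Multiset.toFinsupp_toMultiset, graft_branches]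

/-- The graded dual of `HK`: the linear functionals vanishing on all but finitely many of the
homogeneous parts. -/
def GradedDual : Submodule k (Module.Dual k (HK k)) where
  carrier := {f | ∃ M, ∀ n, M < n → ∀ u ∈ HKdeg k n, f u = 0}
  zero_mem' := ⟨0, fun _ _ _ _ => rfl⟩
  add_mem' := by
    rintro f g ⟨M, hM⟩ ⟨M', hM'⟩
    refine ⟨max M M', fun n hn u hu => ?_⟩
    rw [LinearMap.add_apply, hM n (lt_of_le_of_lt (le_max_left _ _) hn) u hu,
      hM' n (lt_of_le_of_lt (le_max_right _ _) hn) u hu, add_zero]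
  smul_mem' := by
    rintro c f ⟨M, hM⟩
    refine ⟨M, fun n hn u hu => ?_⟩
    rw [LinearMap.smul_apply, hM n hn u hu, smul_zero]

theorem mkDerivation_mem_HKdeg {a b : ℕ} (hb : b ≤ 1) {g : RTree → HK k}
    (hg : ∀ t m, m + b = size t + a → g t ∈ HKdeg k m) {n m : ℕ} (hm : m + b = n + a)
    {u : HK k} (hu : u ∈ HKdeg k n) : mkDerivation k g u ∈ HKdeg k m := by
  rw [u.as_sum, map_sum]
  refine Submodule.sum_mem _ fun s hs => ?_
  have hw : Finsupp.weight size s = n := hu (mem_support_iff.1 hs)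
  rw [mkDerivation_monomial]
  refine Submodule.smul_mem _ _ (Submodule.sum_mem _ fun i hi => ?_)
  have h1 := Finsupp.weight_sub_single_add (w := size) (Finsupp.mem_support_iff.1 hi)
  have h2 := size_pos i
  have h3 := hg i (size i + a - b) (by omega)
  have h4 := (isWeightedHomogeneous_monomial size (s - Finsupp.single i 1) (s i : k) rfl).mul h3
  have h5 : Finsupp.weight size (s - Finsupp.single i 1) + (size i + a - b) = m := by omega
  rw [h5] at h4
  exact h4

theorem treeIncl_mem_HKdeg {v : TreeSpace k} {m : ℕ} (h : ∀ t, v t ≠ 0 → size t = m) :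
    treeIncl k v ∈ HKdeg k m := by
  rw [treeIncl, Finsupp.linearCombination_apply]
  refine Submodule.sum_mem _ fun t ht => Submodule.smul_mem _ _ ?_
  rw [← h t (Finsupp.mem_support_iff.1 ht)]
  exact isWeightedHomogeneous_X k size t

theorem growthK_mem_HKdeg {n : ℕ} {u : HK k} (hu : u ∈ HKdeg k n) :
    growthK k u ∈ HKdeg k (n + 1) := by
  refine mkDerivation_mem_HKdeg k (a := 1) (b := 0) (by omega) (fun t m hm => ?_) rfl hu
  refine treeIncl_mem_HKdeg k fun t' ht' => ?_
  rw [growth, Finsupp.linearCombination_single, one_smul] at ht'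
  have := size_of_growthMult (t := t) (t' := t') fun h => ht' (by
    simp [Finsupp.ofSupportFinite_coe, h])
  omega

theorem pruneK_mem_HKdeg {n : ℕ} {u : HK k} (hu : u ∈ HKdeg k (n + 1)) :
    pruneK k u ∈ HKdeg k n := by
  refine mkDerivation_mem_HKdeg k (a := 0) (b := 1) le_rfl (fun t m hm => ?_) rfl hu
  split_ifs with h
  · have h1 : size bullet = 1 := by rw [bullet, size_graft]; simp
    obtain rfl : m = 0 := by rw [h, h1] at hm; omega
    exact isWeightedHomogeneous_one k size
  · refine treeIncl_mem_HKdeg k fun t' ht' => ?_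
    rw [pruning, Finsupp.linearCombination_single, one_smul] at ht'
    have := size_of_pruneMult (t := t') (t' := t) fun h => ht' (by
      simp [Finsupp.ofSupportFinite_coe, h])
    omega

/-- The dual `N*` of `N`, given by `⟨N* f, u⟩ = ⟨f, N u⟩`. -/
def dualGrowthK : GradedDual k →ₗ[k] GradedDual k :=
  (growthK k : HK k →ₗ[k] HK k).dualMap.restrict (by
    rintro f ⟨M, hM⟩
    exact ⟨M, fun n hn u hu => hM (n + 1) (by omega) _ (growthK_mem_HKdeg k hu)⟩)

/-- The dual `P*` of `P`, given by `⟨P* f, u⟩ = ⟨f, P u⟩`. -/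
def dualPruneK : GradedDual k →ₗ[k] GradedDual k :=
  (pruneK k : HK k →ₗ[k] HK k).dualMap.restrict (by
    rintro f ⟨M, hM⟩
    refine ⟨M + 1, fun n hn u hu => ?_⟩
    obtain ⟨n, rfl⟩ : ∃ n', n = n' + 1 := ⟨n - 1, by omega⟩
    exact hM n (by omega) _ (pruneK_mem_HKdeg k hu))

/-! ### The isomorphism `χ` -/

theorem treeInner_single (v : TreeSpace k) (t : RTree) (r : k) :
    treeInner k v (Finsupp.single t r) = v t * symCard t * r := by
  induction v using Finsupp.induction_linear with
  | zero => simp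
  | add v w hv hw => rw [map_add, LinearMap.add_apply, hv, hw, Finsupp.add_apply]; ring
  | single s c =>
    rw [treeInner, Finsupp.linearCombination_single]
    by_cases h : s = t
    · subst h
      simp [mul_assoc]
    · simp [h, Ne.symm h]

theorem Bplus_symm_single_mem (t : RTree) (r : k) :
    (Bplus k).symm (Finsupp.single t r) ∈ HKdeg k (size t - 1) := by
  rw [Bplus_symm_single]
  refine isWeightedHomogeneous_monomial _ _ _ ?_
  rw [size_eq, Nat.add_sub_cancel]
  induction t.branches using Multiset.induction_on with
  | empty => simp
  | cons a u ih =>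
    rw [← Multiset.singleton_add, map_add, map_add, ih, Multiset.toFinsupp_singleton,
      Finsupp.weight_single]
    simp

theorem Bplus_apply_ne_zero {n : ℕ} {u : HK k} (hu : u ∈ HKdeg k n) {t : RTree}
    (h : Bplus k u t ≠ 0) : size t = n + 1 := by
  by_contra hne
  apply h
  have h0 : Bplus k u t = coeff (Multiset.toFinsupp t.branches) u := rfl
  rw [h0]
  by_contra hc
  have h1 := hu hc
  have h2 := Bplus_symm_single_mem k t 1
  rw [Bplus_symm_single] at h2
  have h3 := h2 (d := Multiset.toFinsupp t.branches) (by simp)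
  have := size_pos t
  omega

/-- The map `χ` as a linear map, `⟨χ(t), u⟩ = (t, B₊(u))`. -/
def chiMap : TreeSpace k →ₗ[k] GradedDual k :=
  ((Bplus k : HK k →ₗ[k] TreeSpace k).dualMap ∘ₗ treeInner k).codRestrict (GradedDual k) (by
    intro v
    refine ⟨v.support.sup size, fun n hn u hu => ?_⟩
    show treeInner k v (Bplus k u) = 0
    rw [← Finsupp.sum_single (Bplus k u), Finsupp.sum, map_sum]
    refine Finset.sum_eq_zero fun t ht => ?_
    rw [treeInner_single]
    have h1 := Bplus_apply_ne_zero k hu (Finsupp.mem_support_iff.1 ht)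
    have h2 : v t = 0 := by
      by_contra hv
      have := Finset.le_sup (f := size) (Finsupp.mem_support_iff.2 hv)
      omega
    rw [h2]
    simp)

theorem chiMap_bijective [CharZero k] : Function.Bijective (chiMap k) := by
  have hsym : ∀ t : RTree, (symCard t : k) ≠ 0 := fun t =>
    Nat.cast_ne_zero.2 (symCard_pos t).ne'
  have happ : ∀ v t, (chiMap k v : Module.Dual k (HK k)) ((Bplus k).symm (Finsupp.single t 1)) =
      v t * symCard t := by
    intro v t
    show treeInner k v (Bplus k ((Bplus k).symm (Finsupp.single t 1))) = _
    rw [LinearEquiv.apply_symm_apply, treeInner_single, mul_one]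
  constructor
  · refine (injective_iff_map_eq_zero (chiMap k)).2 fun v hv => ?_
    ext t
    have := happ v t
    rw [hv] at this
    exact (mul_eq_zero.1 this.symm).resolve_right (hsym t)
  · rintro ⟨f, M, hM⟩
    refine ⟨Finsupp.ofSupportFinite
      (fun t => f ((Bplus k).symm (Finsupp.single t 1)) / symCard t)
      ((finite_size_le (M + 1)).subset fun t ht => ?_), ?_⟩
    · by_contra hlt
      apply ht
      change ¬ size t ≤ M + 1 at hlt
      show f _ / _ = 0
      rw [hM (size t - 1) (by omega) _ (Bplus_symm_single_mem k t 1), zero_div]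
    · apply Subtype.ext
      refine LinearMap.ext fun u => ?_
      obtain ⟨w, rfl⟩ := (Bplus k).symm.surjective u
      induction w using Finsupp.induction_linear with
      | zero => simp
      | add v w hv hw => rw [map_add, map_add, map_add, hv, hw]
      | single t r =>
        have hr : Finsupp.single t r = r • Finsupp.single t (1 : k) := by simp
        rw [hr, map_smul, map_smul, map_smul, happ, Finsupp.ofSupportFinite_coe,
          div_mul_cancel₀ _ (hsym t)]

/-- The isomorphism `χ` from `k{𝒯}` to the graded dual of `HK`, with
`⟨χ(t), u⟩ = (t, B₊(u))`. -/
def chi [CharZero k] : TreeSpace k ≃ₗ[k] GradedDual k :=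
  LinearEquiv.ofBijective (chiMap k) (chiMap_bijective k)

theorem chi_apply [CharZero k] (v : TreeSpace k) (u : HK k) :
    (chi k v : Module.Dual k (HK k)) u = treeInner k v (Bplus k u) := rfl

end Linear

end RootedTrees

end

open RootedTrees

noncomputable section

open scoped Classical

namespace RootedTrees

open PlaneTree RTree MvPolynomial

/-! Transported along `χ`, both claims are statements about adjoints for the form `(w, u) ↦ (B₊ w,
B₊ u)` on forests. Monomials are orthogonal for it, and since repeated branches contribute
factorials to `|SG|`, multiplication by a tree `t` is adjoint to `|SG(t)| ∂/∂t`
(`forestInner_X_mul`).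

Deleting the root gives `𝔑 B₊ = B₊ (X• + N)` and `𝔓 B₊ = B₊ P` (`growth_Bplus`, `pruning_Bplus`).
The core is that `𝔑` and `𝔓` are adjoint on trees, by induction on the tree. If this holds for the
components of a forest, then `N` is adjoint there to `P - ∂/∂•`, the derivation extending `𝔓`; this
is a commutator computation with `∂/∂t` (`forestInner_growthK_of_forall`). The operator `X•` is
adjoint to `∂/∂•` because `|SG(•)| = 1`, so `X• + N` is adjoint to `P`, which is the claim for the
grafted tree.

The first formula is then `(v, 𝔓 B₊ u) = (𝔑 v, B₊ u)`, and the second is the adjointness of `N` and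
`P - ∂/∂•`. -/

theorem RTree.graft_injective : Function.Injective graft :=
  Function.LeftInverse.injective branches_graft

theorem RTree.mk_node (n : ℕ) (c : Fin n → PlaneTree) :
    mk (node n c) = graft (Finset.univ.val.map fun i => mk (c i)) := by
  rw [← branches_mk, graft_branches]

theorem RTree.mk_eq_bullet_iff (s : PlaneTree) : mk s = bullet ↔ s.arity = 0 := by
  obtain ⟨n, c⟩ := s
  rw [mk_node, bullet, graft_injective.eq_iff, Multiset.map_eq_zero]
  change _ ↔ n = 0
  rw [← Multiset.card_eq_zero]
  simp

/-- The factorials count the permutations of isomorphic branches at the root. -/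
theorem RTree.symCard_eq (t : RTree) :
    symCard t = (∏ x ∈ t.branches.toFinset, (t.branches.count x).factorial) *
      (t.branches.map symCard).prod := by
  obtain ⟨⟨n, c⟩⟩ := t
  change Nat.card (SymmetryGroup (node n c)) =
    (∏ x ∈ (Finset.univ.val.map fun i => mk (c i)).toFinset,
      ((Finset.univ.val.map fun i => mk (c i)).count x).factorial) *
      ((Finset.univ.val.map fun i => mk (c i)).map symCard).prod
  rw [card_symmetryGroup_node, Multiset.map_map]
  congr 1
  -- The root symmetries form the stabilizer of the labelling of positions by isomorphism classes;
  -- its order is the product of the factorials of the fibre sizes.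
  have h := DomMulAct.stabilizer_card' (fun i : Fin n => mk (c i))
  have h1 : Nat.card (rootSymmetry (node n c)) =
      Fintype.card {g : Equiv.Perm (Fin n) // (fun i => mk (c i)) ∘ g = fun i => mk (c i)} := by
    rw [← Nat.card_eq_fintype_card]
    refine Nat.card_congr (Equiv.subtypeEquivRight fun σ => ?_)
    exact funext_iff.symm
  rw [h1, h]
  refine Finset.prod_congr rfl fun x _ => ?_
  rw [Multiset.count_map, Fintype.card_subtype]
  congr 1
  simp only [eq_comm]
  rfl

/-- A further copy of `t` raises one factorial `m!` to `(m + 1)!`. The factor `m + 1` is what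
differentiating a monomial produces, whence `forestInner_X_mul`. -/
theorem RTree.symCard_graft_cons (t : RTree) (u : Multiset RTree) :
    symCard (graft (t ::ₘ u)) = (u.count t + 1) * symCard t * symCard (graft u) := by
  rw [symCard_eq, symCard_eq (graft u), branches_graft, branches_graft, Multiset.map_cons,
    Multiset.prod_cons, Multiset.toFinset_cons]
  -- If `t` is absent from `u`, including it in the index set only adds a factor `0! = 1`.
  have h : ∏ x ∈ u.toFinset, (u.count x).factorial =
      ∏ x ∈ insert t u.toFinset, (u.count x).factorial := by
    refine Finset.prod_subset (Finset.subset_insert _ _) fun x _ hx => ?_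
    rw [Multiset.mem_toFinset] at hx
    rw [Multiset.count_eq_zero_of_notMem hx, Nat.factorial_zero]
  rw [h, ← Finset.mul_prod_erase _ _ (Finset.mem_insert_self t _),
    ← Finset.mul_prod_erase _ _ (Finset.mem_insert_self t _), Multiset.count_cons_self,
    Nat.factorial_succ]
  have h2 : ∏ x ∈ (insert t u.toFinset).erase t, ((t ::ₘ u).count x).factorial =
      ∏ x ∈ (insert t u.toFinset).erase t, (u.count x).factorial :=
    Finset.prod_congr rfl fun x hx => by
      rw [Multiset.count_cons_of_ne (Finset.ne_of_mem_erase hx)]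
  rw [h2]
  ring

/-! ### Growth, pruning and grafting on plane representatives -/

variable (k : Type*) [Field k]

theorem growth_single_mk (s : PlaneTree) :
    growth k (Finsupp.single (mk s) 1) =
      ∑ v : Vertex s, Finsupp.single (attach s fun w => if w = v then {bullet} else 0) 1 := by
  ext t
  rw [growth, Finsupp.linearCombination_single, one_smul, Finsupp.ofSupportFinite_coe,
    Finsupp.finsetSum_apply]
  simp only [Finsupp.single_apply]
  rw [Finset.sum_boole]
  congr 1
  exact (Nat.card_eq_fintype_card).trans (Fintype.card_subtype _)

theorem pruning_single_mk (s : PlaneTree) :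
    pruning k (Finsupp.single (mk s) 1) =
      ∑ a : Edge s, if IsTerminal s a then Finsupp.single (prune s a) 1 else 0 := by
  ext t
  rw [pruning, Finsupp.linearCombination_single, one_smul, Finsupp.ofSupportFinite_coe,
    Finsupp.finsetSum_apply]
  have h : ∀ a : Edge s, (if IsTerminal s a then Finsupp.single (prune s a) (1 : k) else 0) t =
      if IsTerminal s a ∧ prune s a = t then 1 else 0 := by
    intro a
    by_cases h : IsTerminal s a <;> simp [h, Finsupp.single_apply]
  simp only [h]
  rw [Finset.sum_boole]
  congr 1
  exact (Nat.card_eq_fintype_card).trans (Fintype.card_subtype _)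

theorem treeIncl_single (t : RTree) : treeIncl k (Finsupp.single t 1) = X t := by
  simp [treeIncl]

theorem Bplus_prod_X (u : Multiset RTree) :
    Bplus k (u.map X).prod = Finsupp.single (graft u) 1 := by
  have h : (u.map (X : RTree → HK k)).prod = monomial (Multiset.toFinsupp u) 1 := by
    induction u using Multiset.induction_on with
    | empty => simp
    | cons a u ih =>
      rw [Multiset.map_cons, Multiset.prod_cons, ih, ← Multiset.singleton_add, map_add,
        Multiset.toFinsupp_singleton, X, monomial_mul, one_mul]
  rw [h, Bplus_monomial, Multiset.toFinsupp_toMultiset]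

theorem Bplus_finset_prod_X {ι : Type*} (s : Finset ι) (f : ι → RTree) :
    Bplus k (∏ i ∈ s, X (f i)) = Finsupp.single (graft (s.val.map f)) 1 := by
  rw [← Bplus_prod_X, Multiset.map_map]
  rfl

theorem Bplus_prod_X_fin {n : ℕ} (c : Fin n → PlaneTree) :
    Bplus k (∏ i, X (mk (c i))) = Finsupp.single (mk (node n c)) 1 := by
  rw [Bplus_finset_prod_X, mk_node]

theorem Bplus_X_mul_finset_prod {ι : Type*} (s : Finset ι) (f : ι → RTree) (t : RTree) :
    Bplus k (X t * ∏ i ∈ s, X (f i)) = Finsupp.single (graft (t ::ₘ s.val.map f)) 1 := by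
  rw [← Bplus_prod_X, Multiset.map_cons, Multiset.prod_cons, Multiset.map_map]
  rfl

variable {k} in
-- Every tree has a plane representative, so these products are all the monomials. Indexing by `Fin
-- n` matches the decomposition of the vertices and edges of `node n c`.
theorem HK_linearMap_ext {M : Type*} [AddCommGroup M] [Module k M] {f g : HK k →ₗ[k] M}
    (h : ∀ (n : ℕ) (c : Fin n → PlaneTree), f (∏ i, X (mk (c i))) = g (∏ i, X (mk (c i)))) :
    f = g := by
  suffices hs : f ∘ₗ (Bplus k).symm.toLinearMap = g ∘ₗ (Bplus k).symm.toLinearMap by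
    refine LinearMap.ext fun w => ?_
    simpa using LinearMap.congr_fun hs (Bplus k w)
  refine Finsupp.lhom_ext' fun t => LinearMap.ext_ring ?_
  obtain ⟨⟨n, c⟩⟩ := t
  have hb : (Bplus k).symm (Finsupp.single (mk (node n c)) 1) = ∏ i, X (mk (c i)) := by
    rw [LinearEquiv.symm_apply_eq, Bplus_prod_X_fin]
  change f ((Bplus k).symm (Finsupp.single (mk (node n c)) 1)) =
    g ((Bplus k).symm (Finsupp.single (mk (node n c)) 1))
  rw [hb, h]

/-! ### Growth and pruning of a grafted forest -/

theorem derivation_prod {ι : Type*} [DecidableEq ι] (D : Derivation k (HK k) (HK k))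
    (s : Finset ι) (f : ι → HK k) :
    D (∏ i ∈ s, f i) = ∑ i ∈ s, D (f i) * ∏ j ∈ s.erase i, f j := by
  induction s using Finset.induction_on with
  | empty => simp
  | insert a s ha ih =>
    rw [Finset.prod_insert ha, D.leibniz, ih, Finset.sum_insert ha, Finset.erase_insert ha,
      smul_eq_mul, smul_eq_mul, add_comm, mul_comm (D (f a)), Finset.mul_sum]
    congr 1
    refine Finset.sum_congr rfl fun i hi => ?_
    have hia : a ≠ i := fun h => ha (h ▸ hi)
    rw [Finset.erase_insert_of_ne hia, Finset.prod_insert (by simp [ha])]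
    ring

theorem RTree.attach_node (n : ℕ) (c : Fin n → PlaneTree)
    (F : Option ((i : Fin n) × Vertex (c i)) → Multiset RTree) :
    attach (node n c) F =
      graft (F none + Finset.univ.val.map fun i => attach (c i) fun v => F (some ⟨i, v⟩)) :=
  rfl

theorem RTree.attach_zero (s : PlaneTree) : attach s (fun _ => 0) = mk s := by
  induction s with
  | node n c ih =>
    refine (attach_node n c fun _ => 0).trans ?_
    simp only [zero_add, ih, mk_node]

/-- The decidability instance is pinned to the classical one, which is used for vertices of a
general tree; `Option` would supply another. -/
theorem RTree.attach_bullet_root (n : ℕ) (c : Fin n → PlaneTree) :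
    attach (node n c)
        (fun w : Option ((i : Fin n) × Vertex (c i)) =>
          @ite _ (w = none) (Classical.propDecidable _) {bullet} 0) =
      graft (bullet ::ₘ Finset.univ.val.map fun i => mk (c i)) := by
  rw [attach_node]
  simp [attach_zero]

theorem RTree.attach_bullet_branch (n : ℕ) (c : Fin n → PlaneTree) (i : Fin n)
    (v : Vertex (c i)) :
    attach (node n c)
        (fun w : Option ((i : Fin n) × Vertex (c i)) =>
          @ite _ (w = some ⟨i, v⟩) (Classical.propDecidable _) {bullet} 0) =
      graft (attach (c i) (fun w => if w = v then {bullet} else 0) ::ₘ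
        (Finset.univ.erase i).val.map fun j => mk (c j)) := by
  rw [attach_node, if_neg (by simp), zero_add, ← Finset.insert_erase (Finset.mem_univ i),
    Finset.insert_val_of_notMem (Finset.notMem_erase i _), Multiset.map_cons,
    Finset.erase_insert (Finset.notMem_erase i _)]
  congr 2
  · congr 1
    funext w
    simp
  · refine Multiset.map_congr rfl fun j hj => ?_
    -- The branches other than the `i`-th receive empty forests and stay unchanged.
    have hji : j ≠ i := (Finset.mem_erase.1 (show j ∈ Finset.univ.erase i from hj)).1
    rw [← attach_zero]
    congr 1
    funext w
    simp [hji]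

/-- Growing a tree either adds a branch `•` at the root or makes one of the branches grow. -/
theorem growth_Bplus (w : HK k) :
    growth k (Bplus k w) = Bplus k (X bullet * w + growthK k w) := by
  refine LinearMap.congr_fun (f := growth k ∘ₗ (Bplus k).toLinearMap)
    (g := (Bplus k).toLinearMap ∘ₗ (LinearMap.mulLeft k (X bullet) +
      (growthK k : HK k →ₗ[k] HK k))) (HK_linearMap_ext fun n c => ?_) w
  change growth k (Bplus k (∏ i, X (mk (c i)))) =
    Bplus k (X bullet * ∏ i, X (mk (c i)) + growthK k (∏ i, X (mk (c i))))
  rw [Bplus_prod_X_fin, growth_single_mk, map_add, Bplus_X_mul_finset_prod, derivation_prod,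
    map_sum]
  change ∑ v : Option ((i : Fin n) × Vertex (c i)), _ = _
  rw [Fintype.sum_option, Fintype.sum_sigma]
  congr 1
  · congr 1
    exact attach_bullet_root n c
  · refine Finset.sum_congr rfl fun i _ => ?_
    rw [growthK, mkDerivation_X, growth_single_mk, map_sum, Finset.sum_mul, map_sum]
    refine Finset.sum_congr rfl fun v _ => ?_
    rw [treeIncl_single, Bplus_X_mul_finset_prod]
    congr 1
    exact attach_bullet_branch n c i v

/-- Since `𝔓(•) = 0`, the exceptional value `P(•) = 1` can be added to `𝔓` as a correction, which
removes the case distinction. -/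
theorem pruneK_X_mk (s : PlaneTree) :
    pruneK k (X (mk s)) =
      (if s.arity = 0 then 1 else 0) + treeIncl k (pruning k (Finsupp.single (mk s) 1)) := by
  rw [pruneK, mkDerivation_X]
  by_cases h : s.arity = 0
  · rw [if_pos h, if_pos ((mk_eq_bullet_iff s).2 h)]
    obtain ⟨n, c⟩ := s
    obtain rfl : n = 0 := h
    rw [pruning_single_mk]
    change (1 : HK k) = 1 + treeIncl k (∑ a : (i : Fin 0) × Option (Edge (c i)), _)
    rw [Fintype.sum_sigma]
    simp
  · rw [if_neg h, if_neg (mt (mk_eq_bullet_iff s).1 h), zero_add]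

/-- Pruning a tree either removes a branch `•` at the root or prunes one of the branches. -/
theorem pruning_Bplus (w : HK k) : pruning k (Bplus k w) = Bplus k (pruneK k w) := by
  refine LinearMap.congr_fun (f := pruning k ∘ₗ (Bplus k).toLinearMap)
    (g := (Bplus k).toLinearMap ∘ₗ (pruneK k : HK k →ₗ[k] HK k))
    (HK_linearMap_ext fun n c => ?_) w
  change pruning k (Bplus k (∏ i, X (mk (c i)))) = Bplus k (pruneK k (∏ i, X (mk (c i))))
  rw [Bplus_prod_X_fin, pruning_single_mk, derivation_prod, map_sum]
  change ∑ a : (i : Fin n) × Option (Edge (c i)), _ = _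
  rw [Fintype.sum_sigma]
  refine Finset.sum_congr rfl fun i _ => ?_
  rw [Fintype.sum_option, pruneK_X_mk, add_mul, map_add]
  congr 1
  -- The edge from the root to the `i`-th branch is terminal exactly when that branch is `•`; the
  -- value `P(•) = 1` accounts for its removal.
  · by_cases h : (c i).arity = 0
    · rw [if_pos h, one_mul, Bplus_finset_prod_X]
      exact if_pos h
    · rw [if_neg h, zero_mul, map_zero]
      exact if_neg h
  · rw [pruning_single_mk, map_sum, Finset.sum_mul, map_sum]
    refine Finset.sum_congr rfl fun a _ => ?_
    by_cases h : IsTerminal (c i) a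
    · rw [if_pos h, treeIncl_single, Bplus_X_mul_finset_prod]
      exact if_pos h
    · rw [if_neg h, map_zero, zero_mul, map_zero]
      exact if_neg h

/-! ### The symmetric form on forests and its adjoints -/

theorem treeInner_comm (v w : TreeSpace k) : treeInner k v w = treeInner k w v := by
  induction w using Finsupp.induction_linear with
  | zero => simp
  | add w w' h h' => rw [map_add, h, h', map_add, LinearMap.add_apply]
  | single t r =>
    rw [treeInner_single, treeInner, Finsupp.linearCombination_single]
    simp
    ring

/-- The inner product of forests obtained from that of trees by joining roots. -/
def forestInner : HK k →ₗ[k] HK k →ₗ[k] k :=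
  (treeInner k).compl₁₂ (Bplus k).toLinearMap (Bplus k).toLinearMap

theorem forestInner_apply (w u : HK k) :
    forestInner k w u = treeInner k (Bplus k w) (Bplus k u) := rfl

theorem forestInner_monomial (a b : RTree →₀ ℕ) (r c : k) :
    forestInner k (monomial a r) (monomial b c) =
      if a = b then r * symCard (graft (Finsupp.toMultiset a)) * c else 0 := by
  rw [forestInner_apply, Bplus_monomial, Bplus_monomial, treeInner_single]
  by_cases h : a = b
  · rw [if_pos h, h, Finsupp.single_eq_same]
  · have h' : graft (Finsupp.toMultiset b) ≠ graft (Finsupp.toMultiset a) := fun h' =>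
      h (Multiset.toFinsupp.symm.injective (graft_injective h')).symm
    rw [if_neg h, Finsupp.single_eq_of_ne h', zero_mul, zero_mul]

theorem forestInner_comm (w u : HK k) : forestInner k w u = forestInner k u w :=
  treeInner_comm k _ _

/-- Multiplication by a tree is adjoint to differentiation, up to the order of the symmetry
group. -/
theorem forestInner_X_mul (t : RTree) (w u : HK k) :
    forestInner k (X t * w) u = symCard t * forestInner k w (pderiv t u) := by
  induction w using MvPolynomial.induction_on' with
  | add w w' h h' => rw [mul_add, map_add, LinearMap.add_apply, h, h', map_add,
      LinearMap.add_apply, mul_add]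
  | monomial a r =>
    induction u using MvPolynomial.induction_on' with
    | add u u' h h' => rw [map_add, h, h', map_add, map_add, mul_add]
    | monomial b c =>
      rw [X, monomial_mul, one_mul, pderiv_monomial, forestInner_monomial, forestInner_monomial]
      -- If `t` does not occur in `b`, the derivative vanishes and no multiple of `X t` pairs with
      -- `b`.
      by_cases hb : b t = 0
      · have h1 : Finsupp.single t 1 + a ≠ b := by
          rintro rfl
          simp at hb
        rw [if_neg h1, hb]
        simp
      · have h1 : Finsupp.single t 1 + (b - Finsupp.single t 1) = b :=
          add_tsub_cancel_of_le (Finsupp.single_le_iff.2 (Nat.one_le_iff_ne_zero.2 hb))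
        have h2 : Finsupp.single t 1 + a = b ↔ a = b - Finsupp.single t 1 := by
          conv_lhs => rw [← h1]
          exact add_right_inj _
        by_cases h3 : a = b - Finsupp.single t 1
        -- The multiplicity `b t` appears on both sides: on the left from `symCard_graft_cons`, on
        -- the right as the exponent brought down by differentiation.
        · rw [if_pos (h2.2 h3), if_pos h3, map_add, Finsupp.toMultiset_single, one_smul,
            Multiset.singleton_add, symCard_graft_cons, Finsupp.count_toMultiset, ← h2.2 h3]
          simp
          ring
        · rw [if_neg (mt h2.1 h3), if_neg h3, mul_zero]

/-- By linearity from `forestInner_X_mul`. The adjoint is assembled into a single derivation, so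
that it can later be identified by its values on generators. -/
theorem forestInner_treeIncl_mul (v : TreeSpace k) (w u : HK k) :
    forestInner k (treeIncl k v * w) u =
      forestInner k w ((∑ s ∈ v.support, (v s * symCard s : k) •
        (pderiv s : Derivation k (HK k) (HK k))) u) := by
  rw [treeIncl, Finsupp.linearCombination_apply, Finsupp.sum, Finset.sum_mul, map_sum,
    LinearMap.sum_apply, ← Derivation.coeFnAddMonoidHom_apply, map_sum, Finset.sum_apply, map_sum]
  refine Finset.sum_congr rfl fun s _ => ?_
  rw [smul_mul_assoc, map_smul, LinearMap.smul_apply, forestInner_X_mul,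
    Derivation.coeFnAddMonoidHom_apply, Derivation.smul_apply, map_smul, smul_eq_mul, smul_eq_mul,
    mul_assoc]

/-! ### Adjointness of growth and pruning -/

theorem pderiv_treeIncl (t : RTree) (v : TreeSpace k) :
    pderiv t (treeIncl k v) = C (v t) := by
  induction v using Finsupp.induction_linear with
  | zero => simp
  | add v w hv hw => rw [map_add, map_add, hv, hw, Finsupp.add_apply, C_add]
  | single s r =>
    rw [treeIncl, Finsupp.linearCombination_single, Derivation.map_smul, pderiv_X, smul_eq_C_mul,
      Finsupp.single_apply, Pi.single_apply]
    by_cases h : s = t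
    · rw [if_pos h, if_pos h, mul_one]
    · rw [if_neg h, if_neg h, mul_zero, C_0]

/-- The derivation extending the pruning operator `𝔓`. -/
def branchPruneK : Derivation k (HK k) (HK k) := pruneK k - pderiv bullet

theorem branchPruneK_apply (u : HK k) : branchPruneK k u = pruneK k u - pderiv bullet u := rfl

theorem branchPruneK_X (t : RTree) :
    branchPruneK k (X t) = treeIncl k (pruning k (Finsupp.single t 1)) := by
  obtain ⟨s⟩ := t
  change pruneK k (X (mk s)) - pderiv bullet (X (mk s)) =
    treeIncl k (pruning k (Finsupp.single (mk s) 1))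
  rw [pruneK_X_mk, pderiv_X, Pi.single_apply]
  by_cases h : s.arity = 0
  · rw [if_pos h, if_pos ((mk_eq_bullet_iff s).2 h), add_sub_cancel_left]
  · rw [if_neg h, if_neg (mt (mk_eq_bullet_iff s).1 h), zero_add, sub_zero]

/-- Pruning inside a branch never removes the whole branch, so the empty forest does not occur in
the result. This would fail for `P`, since `P(•) = 1`. -/
theorem forestInner_one_branchPruneK (u : HK k) : forestInner k 1 (branchPruneK k u) = 0 := by
  refine LinearMap.congr_fun (f := forestInner k 1 ∘ₗ (branchPruneK k : HK k →ₗ[k] HK k))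
    (g := 0) (HK_linearMap_ext fun n c => ?_) u
  change forestInner k 1 (branchPruneK k (∏ i, X (mk (c i)))) = 0
  rw [derivation_prod, map_sum]
  refine Finset.sum_eq_zero fun i _ => ?_
  rw [branchPruneK_X, forestInner_comm, forestInner_treeIncl_mul, Derivation.map_one_eq_zero,
    map_zero]

/-- If growth and pruning are adjoint on the components of a forest, they are adjoint as
derivations on that forest. -/
theorem forestInner_growthK_of_forall (w : Multiset RTree)
    (hw : ∀ t ∈ w, ∀ s, growth k (Finsupp.single t 1) s * symCard s =
      symCard t * pruning k (Finsupp.single s 1) t) (u : HK k) :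
    forestInner k (growthK k (w.map X).prod) u =
      forestInner k (w.map X).prod (branchPruneK k u) := by
  -- The induction hypothesis is needed at `∂u/∂t`, hence for all `u`.
  induction w using Multiset.induction_on generalizing u with
  | empty =>
    rw [Multiset.map_zero, Multiset.prod_zero, Derivation.map_one_eq_zero, map_zero,
      LinearMap.zero_apply, forestInner_one_branchPruneK]
  | cons t w ih =>
    have ht := hw t (Multiset.mem_cons_self t w)
    -- Both sides are derivations, so generators suffice. As `∂/∂t` sends a generator to a constant,
    -- which `branchPruneK` kills, the commutator takes `r` to the coefficient of `t` in `𝔓(r)`; the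
    -- hypothesis on `t` then applies.
    have hcomm : (∑ s ∈ (growth k (Finsupp.single t 1)).support,
        (growth k (Finsupp.single t 1) s * symCard s : k) •
          (pderiv s : Derivation k (HK k) (HK k))) =
        (symCard t : k) • ⁅(pderiv t : Derivation k (HK k) (HK k)), branchPruneK k⁆ := by
      refine derivation_ext fun r => ?_
      rw [Derivation.smul_apply, Derivation.commutator_apply, branchPruneK_X, pderiv_treeIncl,
        pderiv_X, ← Derivation.coeFnAddMonoidHom_apply, map_sum, Finset.sum_apply]
      have h0 : branchPruneK k (Pi.single (M := fun _ => HK k) t 1 r) = 0 := by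
        rw [Pi.single_apply]
        split_ifs
        · exact Derivation.map_one_eq_zero _
        · exact map_zero _
      rw [h0, sub_zero, smul_eq_C_mul, ← C_mul, ← ht r, Finset.sum_eq_single r]
      · simp [smul_eq_C_mul]
      · intro s _ hs
        simp [pderiv_X_of_ne hs.symm]
      · intro hr
        rw [Finsupp.notMem_support_iff.1 hr, zero_mul, zero_smul, map_zero, Pi.zero_apply]
    -- With `D = branchPruneK k` and `w` the remaining product, Leibniz gives `|SG(t)|` times `(w, D
    -- ∂ₜ u) + (w, [∂ₜ, D] u) = (w, ∂ₜ D u)`, which is the pairing of `X t * w` with `D u`.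
    rw [Multiset.map_cons, Multiset.prod_cons, Derivation.leibniz, map_add, LinearMap.add_apply,
      smul_eq_mul, smul_eq_mul, forestInner_X_mul, forestInner_X_mul,
      ih fun s hs => hw s (Multiset.mem_cons_of_mem hs), growthK, mkDerivation_X,
      mul_comm _ (treeIncl k _),
      forestInner_treeIncl_mul, hcomm, Derivation.smul_apply, Derivation.commutator_apply,
      map_smul, map_sub, smul_eq_mul]
    ring

/-- The matrices of growth and pruning are transposes of each other with respect to the inner
product of trees. -/
theorem growth_apply_mul_symCard (t s : RTree) :
    growth k (Finsupp.single t 1) s * symCard s =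
      symCard t * pruning k (Finsupp.single s 1) t := by
  obtain ⟨p⟩ := t
  change growth k (Finsupp.single (mk p) 1) s * symCard s =
    symCard (mk p) * pruning k (Finsupp.single s 1) (mk p)
  induction p generalizing s with
  | node n c ih =>
    have hbullet : symCard bullet = 1 := by
      rw [symCard_eq, bullet, branches_graft]
      simp
    have hw := forestInner_growthK_of_forall k (Finset.univ.val.map fun i => mk (c i)) (by
      intro t ht
      obtain ⟨i, -, rfl⟩ := Multiset.mem_map.1 ht
      exact ih i) ((Bplus k).symm (Finsupp.single s 1))
    have hB := Bplus_prod_X k (Finset.univ.val.map fun i => mk (c i))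
    rw [← mk_node] at hB
    generalize ((Finset.univ.val.map fun i => mk (c i)).map (X : RTree → HK k)).prod = w at hw hB
    have h1 : growth k (Finsupp.single (mk (node n c)) 1) s * symCard s =
        forestInner k (X bullet * w + growthK k w) ((Bplus k).symm (Finsupp.single s 1)) := by
      rw [forestInner_apply, ← growth_Bplus, hB, LinearEquiv.apply_symm_apply, treeInner_single,
        mul_one]
    have h2 : symCard (mk (node n c)) * pruning k (Finsupp.single s 1) (mk (node n c)) =
        forestInner k w (pruneK k ((Bplus k).symm (Finsupp.single s 1))) := by
      rw [forestInner_apply, ← pruning_Bplus, hB, LinearEquiv.apply_symm_apply, treeInner_comm,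
        treeInner_single, mul_one, mul_comm]
    -- The adjoint `∂/∂•` of `X•` cancels the correction in `branchPruneK`, leaving `P`.
    rw [h1, h2, map_add, LinearMap.add_apply, forestInner_X_mul, hbullet, hw, Nat.cast_one,
      one_mul, ← map_add, branchPruneK_apply, add_sub_cancel]

theorem treeInner_growth (v w : TreeSpace k) :
    treeInner k (growth k v) w = treeInner k v (pruning k w) := by
  refine LinearMap.congr_fun₂ (f := treeInner k ∘ₗ growth k)
    (g := (treeInner k).compl₂ (pruning k))
    (Finsupp.lhom_ext' fun t => LinearMap.ext_ring (Finsupp.lhom_ext' fun s =>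
      LinearMap.ext_ring ?_)) v w
  change treeInner k (growth k (Finsupp.single t 1)) (Finsupp.single s 1) =
    treeInner k (Finsupp.single t 1) (pruning k (Finsupp.single s 1))
  rw [treeInner_single, treeInner_comm, treeInner_single, mul_one, mul_one,
    growth_apply_mul_symCard, mul_comm]

theorem forestInner_growthK (w u : HK k) :
    forestInner k (growthK k w) u = forestInner k w (branchPruneK k u) := by
  refine LinearMap.congr_fun (f := (forestInner k).flip u ∘ₗ (growthK k : HK k →ₗ[k] HK k))
    (g := (forestInner k).flip (branchPruneK k u)) (HK_linearMap_ext fun n c => ?_) w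
  have h := forestInner_growthK_of_forall k (Finset.univ.val.map fun i => mk (c i))
    (fun t _ => growth_apply_mul_symCard k t) u
  rw [Multiset.map_map] at h
  exact h

/-! ### Left multiplication by `B₊(•)` -/

theorem glMul_Bplus_X_bullet : glMul k (Bplus k (X bullet)) = growth k := by
  have hB : Bplus k (X bullet) = Finsupp.single (graft {bullet}) 1 := by
    rw [← Bplus_prod_X, Multiset.map_singleton, Multiset.prod_singleton]
  rw [hB, glMul, Finsupp.linearCombination_single, one_smul]
  refine Finsupp.lhom_ext' fun t => LinearMap.ext_ring ?_
  obtain ⟨s⟩ := t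
  change Finsupp.linearCombination k (fun s => glTree k (graft {bullet}) s)
    (Finsupp.single (mk s) 1) = growth k (Finsupp.single (mk s) 1)
  rw [Finsupp.linearCombination_single, one_smul, growth_single_mk]
  -- The branches of `graft {bullet}` index the maps `f`; a variable forest `u` lets their equality
  -- with `{bullet}` be substituted in that index type.
  have h : ∀ u : Multiset RTree, u = {bullet} →
      (∑ f : u → Vertex s,
        Finsupp.single (attach s fun v => (Finset.univ.filter fun x => f x = v).val.map
          fun x : u => (x : RTree)) (1 : k)) =
      ∑ v : Vertex s, Finsupp.single (attach s fun w => if w = v then {bullet} else 0) 1 := by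
    rintro _ rfl
    -- With a single branch to attach, a map `f` amounts to the choice of one vertex of `s`.
    obtain ⟨hu⟩ := Fintype.card_eq_one_iff_nonempty_unique.1
      ((Multiset.card_coe {bullet}).trans (Multiset.card_singleton bullet))
    refine Fintype.sum_equiv (Equiv.funUnique _ _) _ _ fun f => ?_
    congr 2
    funext w
    have hd : ((default : ({bullet} : Multiset RTree)) : RTree) = bullet :=
      Multiset.mem_singleton.1 Multiset.coe_mem
    rw [Finset.univ_unique, Finset.filter_singleton]
    change Multiset.map _ (if f default = w then {default} else ∅ : Finset _).val =
      if w = f default then _ else _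
    by_cases h : f default = w
    · rw [if_pos h, if_pos h.symm, Finset.singleton_val, Multiset.map_singleton, hd]
    · rw [if_neg h, if_neg (Ne.symm h)]
      rfl
  exact h _ (branches_graft _)

end RootedTrees
end

/-! ### The formulas for the transposes of `P` and `N` -/

open RootedTrees
theorem proposition4p5 (k : Type*) [Field k] [CharZero k] :
    ((chi k).symm.toLinearMap ∘ₗ dualPruneK k ∘ₗ (chi k).toLinearMap =
        glMul k (Bplus k (MvPolynomial.X RTree.bullet)) ∧
      glMul k (Bplus k (MvPolynomial.X RTree.bullet)) = growth k) ∧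
    ∀ t : RTree,
      (chi k).symm (dualGrowthK k (chi k (Finsupp.single t 1))) =
        pruning k (Finsupp.single t 1) -
          Bplus k (MvPolynomial.pderiv RTree.bullet
            ((Bplus k).symm (Finsupp.single t 1))) := by
  refine ⟨⟨?_, glMul_Bplus_X_bullet k⟩, fun t => ?_⟩
  · rw [glMul_Bplus_X_bullet]
    refine LinearMap.ext fun v => ?_
    change (chi k).symm (dualPruneK k (chi k v)) = growth k v
    rw [LinearEquiv.symm_apply_eq]
    refine Subtype.ext (LinearMap.ext fun u => ?_)
    change treeInner k v (Bplus k (pruneK k u)) = treeInner k (growth k v) (Bplus k u)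
    rw [treeInner_growth, pruning_Bplus]
  · rw [LinearEquiv.symm_apply_eq]
    refine Subtype.ext (LinearMap.ext fun u => ?_)
    obtain ⟨w, hw⟩ : ∃ w, Bplus k w = Finsupp.single t 1 := (Bplus k).surjective _
    rw [← hw, LinearEquiv.symm_apply_apply, pruning_Bplus, ← map_sub]
    change forestInner k w (growthK k u) = forestInner k (branchPruneK k w) u
    -- `N` acts on the second argument here, so symmetry of the form is used before and after the
    -- adjunction.
    rw [forestInner_comm, forestInner_growthK, forestInner_comm]
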